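/- **Diagrams.** Let $\mathcal D$ be an oriented link diagram in the plane whose underlying 4-regular plane graph is connected and has at least one crossing. At a crossing $\chi$ let $F_0^\chi,F_1^\chi,F_2^\chi,F_3^\chi$ be the faces at its four angles, in counterclockwise order, where $F_0^\chi$ lies in the angle between the two incoming strands. A *state* is a map $\sigma$ from the set of faces to $\{0,1\}$ such that no two faces that share an edge both have the value $1$. Let $|\sigma_\chi|=8\sigma(F_0^\chi)+4\sigma(F_1^\chi)+2\sigma(F_2^\chi)+\sigma(F_3^\chi)\in\{0,1,2,4,5,8,10\}$. The state sum $[\mathcal D]$ is the sum over all states of the product of the following variables: $X_{|\sigma_\chi|}$ for each positive crossing $\chi$, $x_{|\sigma_\chi|}$ for each negative crossing $\chi$, $f_0$ for each face of value $0$, and $f_1$ for each face of value $1$. It is a polynomial in the 16 variables $f_0,f_1,x_i,X_i$ ($i\in\{0,1,2,4,5,8,10\}$), which may be specialized to elements of a commutative ring. **Curls.** Let $\mathcal D$ be obtained from $\mathcal D'$ by removing a curl (a Reidemeister move of type 1), where both diagrams are as above. The four types 1a–1d of curls are given by the sign of the crossing of the curl and by the sense (clockwise or counterclockwise) in which its loop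 is traversed. (The sense is the one seen with the face that the loop bounds inside the loop; equivalently, for a clockwise loop this face is $F_1^\chi$ at the crossing $\chi$ of the curl, and for a counterclockwise loop it is $F_3^\chi$.) **The ring.** Let $\mathcal I\subset\mathcal R=\mathbb Z[s,S]$ be the ideal generated by $1+s+s^2+s^3+s^4$, $1+S+S^2+S^3+S^4$ and $s^4+s^3S+s^2S^2+sS^3+S^4$, and let $\hat s,\hat S$ be the classes of $s,S$ in $\mathcal R/\mathcal I$. Consider the assignment $$f_0=\hat s^2\hat S^2,\quad f_1=\hat s^4+\hat S^4,\quad x_0=X_0=\hat s+\hat S,\quad x_1=x_4=\hat S,\quad X_1=X_4=\hat s,\quad x_2=x_8=\hat s,\quad X_2=X_8=\hat S,$$ $$x_5=X_{10}=-\hat s^2\hat S^4,\qquad x_{10}=X_5=-\hat s^4\hat S^2 .$$ **Lemma.** 1. Let the 16 variables be specialized to elements of a commutative ring such that $$f_0x_0+f_1x_4=f_0x_{10}=f_0x_1+f_1x_5,\qquad f_0X_0+f_1X_4=f_0X_{10}=f_0X_1+f_1X_5 .\tag{$*$}$$ If the loop of the curl is clockwise, or if $x_1=x_4$ and $X_1=X_4$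 (as in the assignment above), then $[\mathcal D']=f_0X_{10}\,[\mathcal D]$ if the crossing of the curl is positive, and $[\mathcal D']=f_0x_{10}\,[\mathcal D]$ if it is negative. 2. The assignment above satisfies $(*)$ in $\mathcal R/\mathcal I$. 3. Under this assignment in $\mathcal R/\mathcal I$, for each of the four types of curls, $[\mathcal D']=-\hat s^4\hat S\,[\mathcal D]$ if the crossing of the curl is positive, and $[\mathcal D']=-\hat s\hat S^4\,[\mathcal D]$ if it is negative. -/

import Mathlib

/-!
# The facial state sum of an oriented link diagram

A connected plane link diagram is encoded by its combinatorial map (rotation system).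
Around a crossing, the four half-edges are numbered `0, 1, 2, 3` counterclockwise in such a way
that `0` and `1` are the incoming ones, `2` and `3` the outgoing ones.  One strand enters by `0`
and leaves by `2`, the other one enters by `1` and leaves by `3`.  The corner (angle) number `i`
lies between the half-edges `i` and `i + 1` (mod 4); thus corner `0` is the distinguished angle
between the two incoming half-edges and corners `0, 1, 2, 3` follow each other counterclockwise.
-/

namespace FacialState

noncomputable section

/-- A half-edge of a 4-valent map with vertex set `X`. The same type numbers the corners:
the corner `(x, i)` is the one immediately counterclockwise after the half-edge `(x, i)`. -/
abbrev HalfEdge (X : Type*) := X × Fin 4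

/-- The two strands at a crossing. -/
inductive Strand
  /-- the strand from half-edge `0` to half-edge `2` -/
  | zeroTwo
  /-- the strand from half-edge `1` to half-edge `3` -/
  | oneThree
  deriving DecidableEq

/-- An oriented link diagram with crossing set `X` on some closed oriented surface:
the half-edges are glued in pairs to form the edges, every edge leads from an outgoing to an
incoming half-edge, and at each crossing one of the two strands is over. -/
structure SurfaceDiagram (X : Type*) where
  /-- the other half-edge of the same edge -/
  mate : HalfEdge X → HalfEdge X
  mate_mate : ∀ h, mate (mate h) = h
  /-- outgoing half-edges (`2`, `3`) are glued to incoming ones (`0`, `1`) and vice versa -/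
  mate_oriented : ∀ h, 2 ≤ (mate h).2 ↔ h.2 < 2
  /-- the strand that is over at a crossing -/
  overStrand : X → Strand

namespace SurfaceDiagram

variable {X : Type*} (D : SurfaceDiagram X)

/-- A crossing is positive when a counterclockwise turn by less than a half-turn takes the direction
of the over strand to the direction of the under strand. The strand from `0` to `2` turns
counterclockwise to the strand from `1` to `3`. -/
def positive (x : X) : Bool := decide (D.overStrand x = Strand.zeroTwo)

/-- The next corner along the boundary of a face (kept on the left): the corner `(x, i)` lies on
the left of the half-edge `(x, i)` traversed away from `x`; if this edge ends with the half-edge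
`(y, j)`, then the next corner of the face is the one just before `(y, j)`. -/
def nextCorner (c : HalfEdge X) : HalfEdge X := ((D.mate c).1, (D.mate c).2 - 1)

/-- The faces: the orbits of corners under `nextCorner`. -/
def Face : Type _ := Quot fun c c' : HalfEdge X => c' = D.nextCorner c

/-- The face that contains a corner. -/
def face (c : HalfEdge X) : D.Face := Quot.mk _ c

instance [Finite X] : Finite D.Face := by unfold Face; infer_instance

instance [Finite X] : Fintype D.Face := Fintype.ofFinite _

/-- Two faces share an edge. The face on the left of the half-edge `h`, traversed away from its
crossing, is `face h`, and the face on its right is `face (mate h)`. -/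
def ShareEdge (F G : D.Face) : Prop := ∃ h : HalfEdge X, F = D.face h ∧ G = D.face (D.mate h)

/-- A state: a colouring of the faces (`true` is black, i.e. `1`; `false` is white, i.e. `0`)
such that two faces that share an edge are not both black. -/
def State : Type _ :=
  {σ : D.Face → Bool // ∀ F G, D.ShareEdge F G → ¬ (σ F = true ∧ σ G = true)}

instance [Finite X] : Finite D.State := by unfold State; infer_instance

instance [Finite X] : Fintype D.State := Fintype.ofFinite _

end SurfaceDiagram

/-- An oriented link diagram in the plane (equivalently, on the sphere) that is connected and has
at least one crossing. Planarity of the connected map is expressed by Euler's formula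
`V - E + F = 2`, where `E = 2 V` as the map is 4-valent. -/
structure LinkDiagram (X : Type*) [Fintype X] extends SurfaceDiagram X where
  exists_crossing : Nonempty X
  connected : ∀ x y : X,
    Relation.ReflTransGen (fun a b => ∃ i j : Fin 4, mate (a, i) = (b, j)) x y
  planar : (Fintype.card X : ℤ) - 2 * Fintype.card X + Fintype.card toSurfaceDiagram.Face = 2

/-- The decimal value of the bit sequence `b 0, b 1, b 2, b 3`. -/
def decimal (b : Fin 4 → Bool) : ℕ :=
  8 * (b 0).toNat + 4 * (b 1).toNat + 2 * (b 2).toNat + (b 3).toNat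

/-- The decimal values of the four-bit sequences without two cyclically consecutive ones. -/
def codes : Finset ℕ := {0, 1, 2, 4, 5, 8, 10}

theorem decimal_mem_codes :
    ∀ b : Fin 4 → Bool, (∀ i, ¬ (b (i + 1) = true ∧ b i = true)) → decimal b ∈ codes := by
  decide

/-- The 16 variables. -/
inductive StateVar
  /-- the variable of a face: `f₀` if it is white, `f₁` if it is black -/
  | face (black : Bool)
  /-- the variable of a crossing: `Xₙ` if it is positive, `xₙ` if it is negative -/
  | crossing (positive : Bool) (n : codes)

/-- The variable `f₀`. -/
def f₀ : StateVar := .face false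

/-- The variable `f₁`. -/
def f₁ : StateVar := .face true

/-- The variable `Xₙ` (if `pos`) or `xₙ` (if not), where `n ∈ {0, 1, 2, 4, 5, 8, 10}`. -/
def cv (pos : Bool) (n : ℕ) (h : n ∈ codes := by decide) : StateVar := .crossing pos ⟨n, h⟩

namespace SurfaceDiagram

variable {X : Type*} (D : SurfaceDiagram X)

theorem face_nextCorner (c : HalfEdge X) : D.face (D.nextCorner c) = D.face c :=
  (Quot.sound (r := fun c c' : HalfEdge X => c' = D.nextCorner c) rfl).symm

theorem shareEdge_corner (x : X) (i : Fin 4) :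
    D.ShareEdge (D.face (x, i + 1)) (D.face (x, i)) := by
  refine ⟨(x, i + 1), rfl, ?_⟩
  rw [← D.face_nextCorner (D.mate (x, i + 1))]
  simp [nextCorner, D.mate_mate]

/-- The bits of the four corners of a crossing, counterclockwise from the distinguished angle. -/
def bits (σ : D.State) (x : X) : Fin 4 → Bool := fun i => σ.1 (D.face (x, i))

/-- The variable that a state induces at a crossing. -/
def crossingVar (σ : D.State) (x : X) : StateVar :=
  .crossing (D.positive x) ⟨decimal (D.bits σ x),
    decimal_mem_codes _ fun i => σ.2 _ _ (D.shareEdge_corner x i)⟩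

/-- The monomial of a state: the product of the variables at the crossings and at the faces. -/
def monomial [Fintype X] (σ : D.State) : MvPolynomial StateVar ℤ :=
  (∏ x : X, MvPolynomial.X (D.crossingVar σ x)) *
    ∏ F : D.Face, MvPolynomial.X (StateVar.face (σ.1 F))

/-- The state sum. -/
def stateSum [Fintype X] : MvPolynomial StateVar ℤ := ∑ σ : D.State, D.monomial σ

/-- The evaluation of a diagram: the state sum, with the variables specialized to elements of a
commutative ring. -/
def eval [Fintype X] {A : Type*} [CommRing A] (v : StateVar → A) : A :=
  MvPolynomial.aeval v D.stateSum

end SurfaceDiagram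

/-- The sense in which the loop of a curl is traversed. -/
inductive Rotation
  | clockwise
  | counterclockwise

/-- The diagram `D` results from the diagram `D'` by removing a curl, i.e. by a Reidemeister move
of type 1. The sign of the crossing of the curl and the sense of its loop give the four types. -/
structure CurlRemoval {X Y : Type*} [Fintype X] [Fintype Y]
    (D' : LinkDiagram X) (D : LinkDiagram Y) where
  /-- the crossing of the curl -/
  crossing : X
  /-- the sense of its loop -/
  rotation : Rotation
  /-- The loop is an edge that bounds a face with one corner. If it is traversed clockwise, it
  leaves by `2`, returns by `1` and bounds corner `1`; if it is traversed counterclockwise, it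
  leaves by `3`, returns by `0` and bounds corner `3`. -/
  loop : match rotation with
    | .clockwise => D'.mate (crossing, 2) = (crossing, 1)
    | .counterclockwise => D'.mate (crossing, 3) = (crossing, 0)
  /-- the crossings of `D` are the other crossings of `D'` -/
  incl : Y → X
  incl_injective : Function.Injective incl
  range_incl : ∀ x : X, x ∈ Set.range incl ↔ x ≠ crossing
  overStrand_incl : ∀ y, D'.overStrand (incl y) = D.overStrand y
  /-- the edges of `D'` that avoid the crossing of the curl are edges of `D` -/
  mate_of_avoid : ∀ h : HalfEdge Y, (D'.mate (incl h.1, h.2)).1 ≠ crossing →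
    D'.mate (incl h.1, h.2) = (incl (D.mate h).1, (D.mate h).2)
  /-- The two other edges at the crossing of the curl are joined to form one edge of `D`. Their
  half-edges at this crossing are `0, 3` (clockwise loop) or `1, 2` (counterclockwise loop), so
  that they are exchanged by `Fin.rev`, i.e. by `j ↦ 3 - j`. -/
  mate_of_meet : ∀ (h : HalfEdge Y) (j : Fin 4), D'.mate (incl h.1, h.2) = (crossing, j) →
    D'.mate (crossing, j.rev) = (incl (D.mate h).1, (D.mate h).2)

/-- The identities `f₀ x₀ + f₁ x₄ = f₀ x₁₀ = f₀ x₁ + f₁ x₅` and the analogous ones for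
`X₀, X₁, X₄, X₅, X₁₀`. -/
def CurlIdentities {A : Type*} [CommRing A] (v : StateVar → A) : Prop :=
  ∀ ε : Bool,
    v f₀ * v (cv ε 0) + v f₁ * v (cv ε 4) = v f₀ * v (cv ε 10) ∧
    v f₀ * v (cv ε 10) = v f₀ * v (cv ε 1) + v f₁ * v (cv ε 5)

/-- The polynomial ring `ℤ[s, S]`, with `s = X 0` and `S = X 1`. -/
abbrev PolyRing := MvPolynomial (Fin 2) ℤ

/-- The ideal generated by `p₁`, `p₂`, `p₃`. -/
def idealI : Ideal PolyRing :=
  let s : PolyRing := MvPolynomial.X 0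
  let S : PolyRing := MvPolynomial.X 1
  Ideal.span {1 + s + s ^ 2 + s ^ 3 + s ^ 4,
    1 + S + S ^ 2 + S ^ 3 + S ^ 4,
    s ^ 4 + s ^ 3 * S + s ^ 2 * S ^ 2 + s * S ^ 3 + S ^ 4}

/-- The quotient ring `ℤ[s, S] / I`. -/
abbrev QuotRing := PolyRing ⧸ idealI

/-- The class of `s`. -/
def sHat : QuotRing := Ideal.Quotient.mk idealI (MvPolynomial.X 0)

/-- The class of `S`. -/
def SHat : QuotRing := Ideal.Quotient.mk idealI (MvPolynomial.X 1)

/-- The assignment of the 16 variables in terms of two elements `s`, `S` of a commutative ring. -/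
def assignment {A : Type*} [CommRing A] (s S : A) : StateVar → A
  | .face false => s ^ 2 * S ^ 2
  | .face true => s ^ 4 + S ^ 4
  | .crossing false ⟨n, _⟩ =>
    if n = 0 then s + S
    else if n = 1 then S
    else if n = 2 then s
    else if n = 4 then S
    else if n = 5 then -(s ^ 2 * S ^ 4)
    else if n = 8 then s
    else -(s ^ 4 * S ^ 2)
  | .crossing true ⟨n, _⟩ =>
    if n = 0 then s + S
    else if n = 1 then s
    else if n = 2 then S
    else if n = 4 then s
    else if n = 5 then -(s ^ 4 * S ^ 2)
    else if n = 8 then S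
    else -(s ^ 2 * S ^ 4)

end

end FacialState

/-! Adding a curl to an edge of `D` creates one crossing and one face, the inside of the loop. Let
`B` be the face around the loop and `A` the face across the edge, opposite to the loop at the new
crossing. The loop face borders only `B`, so a state of `D'` is a state of `D` plus a colour of the
loop face, which must be white if `B` is black. All other local contributions are unchanged.

For a clockwise loop, the new factor, summed over the loop colour, is `f₀ x₀ + f₁ x₄` if `A` and `B`
are white, `f₀ x₁₀` if `B` is black, and `f₀ x₁ + f₁ x₅` if `A` is black; `A` and `B` share an edge,
so they are not both black. The curl identities say that these three factors agree, hence the factor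
leaves the sum. A counterclockwise loop exchanges `x₁` and `x₄`. The bijections `faceEquiv` and
`crossingEquiv` and the criterion `isProper_extend` carry this argument; `eval_eq` concludes it. -/

namespace FacialState

noncomputable section

/-! ### The state sum as a sum over all colourings -/

namespace SurfaceDiagram

variable {X : Type*} (D : SurfaceDiagram X)

/-- No two faces that share an edge are both black. -/
def IsProper (σ : D.Face → Bool) : Prop :=
  ∀ F G, D.ShareEdge F G → ¬ (σ F = true ∧ σ G = true)

theorem isProper_iff (σ : D.Face → Bool) :
    D.IsProper σ ↔
      ∀ h : HalfEdge X, ¬ (σ (D.face h) = true ∧ σ (D.face (D.mate h)) = true) := by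
  refine ⟨fun H h => H _ _ ⟨h, rfl, rfl⟩, ?_⟩
  rintro H F G ⟨h, rfl, rfl⟩
  exact H h

end SurfaceDiagram

/-- The value of the variable of a crossing, extended by zero to all natural numbers. -/
def crossingValue {A : Type*} [CommRing A] (v : StateVar → A) (ε : Bool) (n : ℕ) : A :=
  if h : n ∈ codes then v (.crossing ε ⟨n, h⟩) else 0

namespace SurfaceDiagram

variable {X : Type*} [Fintype X] {A : Type*} [CommRing A] (D : SurfaceDiagram X)

/-- The contribution of the crossings to the weight of a colouring. -/
def crossingWeight (v : StateVar → A) (σ : D.Face → Bool) : A :=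
  ∏ x : X, crossingValue v (D.positive x) (decimal fun i => σ (D.face (x, i)))

/-- The contribution of the faces to the weight of a colouring. -/
def faceWeight (v : StateVar → A) (σ : D.Face → Bool) : A :=
  ∏ F : D.Face, v (.face (σ F))

theorem aeval_monomial (v : StateVar → A) (σ : D.State) :
    MvPolynomial.aeval v (D.monomial σ) = D.crossingWeight v σ.1 * D.faceWeight v σ.1 := by
  have key (x : X) : crossingValue v (D.positive x) (decimal fun i => σ.1 (D.face (x, i))) =
      v (D.crossingVar σ x) :=
    dif_pos (decimal_mem_codes _ fun i => σ.2 _ _ (D.shareEdge_corner x i))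
  simp [monomial, crossingWeight, faceWeight, key]

-- Indexing by all colourings, with improper ones contributing zero, turns the comparison of states
-- into a bijection of function types. The default value of `crossingValue` can only occur at
-- improper colourings.
open Classical in
theorem eval_eq_sum (v : StateVar → A) :
    D.eval v = ∑ σ : D.Face → Bool,
      if D.IsProper σ then D.crossingWeight v σ * D.faceWeight v σ else 0 := by
  rw [← Finset.sum_filter, Finset.sum_subtype (p := D.IsProper) _ (by simp)]
  simp only [eval, stateSum, map_sum, aeval_monomial]
  exact Fintype.sum_equiv (Equiv.refl _) _ _ fun _ => rfl

end SurfaceDiagram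

/-! ### Crossings and edges near a curl -/

namespace CurlRemoval

variable {X Y : Type*} [Fintype X] [Fintype Y] {D' : LinkDiagram X} {D : LinkDiagram Y}
  (r : CurlRemoval D' D)

/-- The number of the corner inside the loop. -/
def loopCorner : Fin 4 :=
  match r.rotation with
  | .clockwise => 1
  | .counterclockwise => 3

theorem loopCorner_eq : r.loopCorner = 1 ∨ r.loopCorner = 3 := by
  unfold loopCorner
  cases r.rotation <;> simp

theorem mate_loop_out :
    D'.mate (r.crossing, r.loopCorner + 1) = (r.crossing, r.loopCorner) := by
  have h := r.loop
  unfold loopCorner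
  split at h
  · simpa using h
  · have := D'.mate_mate (r.crossing, 3)
    rw [h] at this
    simpa using this

theorem mate_loop_in :
    D'.mate (r.crossing, r.loopCorner) = (r.crossing, r.loopCorner + 1) := by
  rw [← r.mate_loop_out, D'.mate_mate]

theorem eq_loop_add (j : Fin 4) : j = r.loopCorner ∨ j = r.loopCorner + 1 ∨
    j = r.loopCorner + 2 ∨ j = r.loopCorner + 3 := by
  generalize r.loopCorner = k
  revert j k
  decide

/-- With `k` the loop corner, `3 - (k + 3) = -k` equals `k + 2` mod 4 exactly because `k` is odd. -/
theorem rev_add_three : (r.loopCorner + 3).rev = r.loopCorner + 2 := by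
  rcases r.loopCorner_eq with h | h <;> rw [h] <;> decide

theorem rev_add_two : (r.loopCorner + 2).rev = r.loopCorner + 3 := by
  rcases r.loopCorner_eq with h | h <;> rw [h] <;> decide

theorem incl_ne (y : Y) : r.incl y ≠ r.crossing := (r.range_incl _).1 ⟨y, rfl⟩

/-- The crossings of `D'` are the crossing of the curl and the crossings of `D`. -/
def crossingEquiv : Option Y ≃ X :=
  Equiv.ofBijective (fun o => o.elim r.crossing r.incl) <| by
    constructor
    · rintro (_ | y) (_ | z) h
      · rfl
      · exact absurd h.symm (r.incl_ne z)
      · exact absurd h (r.incl_ne y)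
      · exact congrArg some (r.incl_injective h)
    · intro x
      by_cases h : x = r.crossing
      · exact ⟨none, h.symm⟩
      · obtain ⟨y, rfl⟩ := (r.range_incl x).2 h
        exact ⟨some y, rfl⟩

@[simp] theorem crossingEquiv_some (y : Y) : r.crossingEquiv (some y) = r.incl y := rfl

@[simp] theorem crossingEquiv_symm_crossing : r.crossingEquiv.symm r.crossing = none :=
  (Equiv.symm_apply_eq _).2 rfl

@[simp] theorem crossingEquiv_symm_incl (y : Y) : r.crossingEquiv.symm (r.incl y) = some y :=
  (Equiv.symm_apply_eq _).2 rfl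

theorem exists_incl_or (x : X) : x = r.crossing ∨ ∃ y, r.incl y = x := by
  by_cases h : x = r.crossing
  · exact Or.inl h
  · exact Or.inr ((r.range_incl x).2 h)

/-- A half-edge of `D` as a half-edge of `D'`. -/
def inclHalf (h : HalfEdge Y) : HalfEdge X := (r.incl h.1, h.2)

theorem inclHalf_injective : Function.Injective r.inclHalf := by
  rintro ⟨y, i⟩ ⟨z, j⟩ h
  simp only [inclHalf, Prod.mk.injEq] at h
  exact Prod.ext (r.incl_injective h.1) h.2

/-- An edge that joins the crossing of the curl to another crossing exists, as `D'` is connected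
and has another crossing. -/
theorem exists_mate_incl : ∃ (j : Fin 4) (h : HalfEdge Y),
    D'.mate (r.crossing, j) = r.inclHalf h := by
  by_contra! H
  have stay (x : X) (hx : Relation.ReflTransGen
      (fun a b => ∃ i j : Fin 4, D'.mate (a, i) = (b, j)) r.crossing x) : x = r.crossing := by
    induction hx with
    | refl => rfl
    | @tail _ c _ hbc ih =>
      obtain ⟨i, j, hij⟩ := hbc
      subst ih
      rcases r.exists_incl_or c with hc | ⟨y, rfl⟩
      · exact hc
      · exact absurd hij (H i (y, j))
  obtain ⟨y⟩ := D.exists_crossing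
  exact r.incl_ne y (stay _ (D'.connected _ _))

/-- Connectedness excludes that the two outer half-edges of the curl are glued to each other: one of
them leads to a crossing of `D`, and `mate_of_meet` then provides the end of the other. -/
theorem exists_ends : ∃ a b : HalfEdge Y,
    D'.mate (r.crossing, r.loopCorner + 3) = r.inclHalf a ∧
    D'.mate (r.crossing, r.loopCorner + 2) = r.inclHalf b := by
  obtain ⟨j, h, hj⟩ := r.exists_mate_incl
  have hj' : D'.mate (r.inclHalf h) = (r.crossing, j) := by rw [← hj, D'.mate_mate]
  have meet := r.mate_of_meet h j hj'
  rcases r.eq_loop_add j with rfl | rfl | rfl | rfl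
  · rw [r.mate_loop_in] at hj
    exact absurd (congrArg Prod.fst hj).symm (r.incl_ne _)
  · rw [r.mate_loop_out] at hj
    exact absurd (congrArg Prod.fst hj).symm (r.incl_ne _)
  · rw [r.rev_add_two] at meet
    exact ⟨_, _, meet, hj⟩
  · rw [r.rev_add_three] at meet
    exact ⟨_, _, hj, meet⟩

/-- The first end of the edge of `D` that carries the curl: its left side is the face opposite to
the loop. -/
def endA : HalfEdge Y := r.exists_ends.choose

/-- The second end of the edge of `D` that carries the curl: its left side is the face around the
loop. -/
def endB : HalfEdge Y := r.exists_ends.choose_spec.choose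

theorem mate_three : D'.mate (r.crossing, r.loopCorner + 3) = r.inclHalf r.endA :=
  r.exists_ends.choose_spec.choose_spec.1

theorem mate_two : D'.mate (r.crossing, r.loopCorner + 2) = r.inclHalf r.endB :=
  r.exists_ends.choose_spec.choose_spec.2

theorem mate_inclHalf_endA : D'.mate (r.inclHalf r.endA) = (r.crossing, r.loopCorner + 3) := by
  rw [← r.mate_three, D'.mate_mate]

theorem mate_inclHalf_endB : D'.mate (r.inclHalf r.endB) = (r.crossing, r.loopCorner + 2) := by
  rw [← r.mate_two, D'.mate_mate]

theorem mate_endA : D.mate r.endA = r.endB := by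
  have h := r.mate_of_meet r.endA _ r.mate_inclHalf_endA
  rw [r.rev_add_three, r.mate_two] at h
  exact (r.inclHalf_injective h).symm

theorem mate_endB : D.mate r.endB = r.endA := by
  rw [← r.mate_endA, D.mate_mate]

/-- A half-edge of `D` either keeps its mate or is an end of the edge that carries the curl. -/
theorem mate_inclHalf_cases (h : HalfEdge Y) :
    D'.mate (r.inclHalf h) = r.inclHalf (D.mate h) ∨ h = r.endA ∨ h = r.endB := by
  by_cases hc : (D'.mate (r.inclHalf h)).1 = r.crossing
  · right
    obtain ⟨j, hj⟩ : ∃ j, D'.mate (r.inclHalf h) = (r.crossing, j) := ⟨_, Prod.ext hc rfl⟩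
    have hm : D'.mate (r.crossing, j) = r.inclHalf h := by rw [← hj, D'.mate_mate]
    rcases r.eq_loop_add j with rfl | rfl | rfl | rfl
    · rw [r.mate_loop_in] at hm
      exact absurd (congrArg Prod.fst hm).symm (r.incl_ne _)
    · rw [r.mate_loop_out] at hm
      exact absurd (congrArg Prod.fst hm).symm (r.incl_ne _)
    · rw [r.mate_two] at hm
      exact Or.inr (r.inclHalf_injective hm).symm
    · rw [r.mate_three] at hm
      exact Or.inl (r.inclHalf_injective hm).symm
  · exact Or.inl (r.mate_of_avoid h hc)

/-! ### Faces before and after the removal -/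

theorem next_zero : D'.nextCorner (r.crossing, r.loopCorner) = (r.crossing, r.loopCorner) := by
  simp [SurfaceDiagram.nextCorner, r.mate_loop_in]

/-- With `k` the loop corner, the corners `k + 1`, `k + 3` are inserted, in this order, between
`endB` and its successor in `D`, and `k + 2` between `endA` and its successor. Thus the boundary
cycles of `D` are only lengthened; the one new cycle is the fixed corner `k`. -/
theorem next_one :
    D'.nextCorner (r.crossing, r.loopCorner + 1) = (r.crossing, r.loopCorner + 3) := by
  simp only [SurfaceDiagram.nextCorner, r.mate_loop_out]
  generalize r.loopCorner = k
  congr 1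
  revert k
  decide

theorem next_two : D'.nextCorner (r.crossing, r.loopCorner + 2) =
    r.inclHalf (D.nextCorner r.endA) := by
  simp [SurfaceDiagram.nextCorner, r.mate_two, r.mate_endA, inclHalf]

theorem next_three : D'.nextCorner (r.crossing, r.loopCorner + 3) =
    r.inclHalf (D.nextCorner r.endB) := by
  simp [SurfaceDiagram.nextCorner, r.mate_three, r.mate_endB, inclHalf]

theorem next_inclHalf_endA :
    D'.nextCorner (r.inclHalf r.endA) = (r.crossing, r.loopCorner + 2) := by
  simp only [SurfaceDiagram.nextCorner, r.mate_inclHalf_endA]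
  generalize r.loopCorner = k
  congr 1
  revert k
  decide

theorem next_inclHalf_endB :
    D'.nextCorner (r.inclHalf r.endB) = (r.crossing, r.loopCorner + 1) := by
  simp only [SurfaceDiagram.nextCorner, r.mate_inclHalf_endB]
  generalize r.loopCorner = k
  congr 1
  revert k
  decide

theorem next_inclHalf_cases (h : HalfEdge Y) :
    D'.nextCorner (r.inclHalf h) = r.inclHalf (D.nextCorner h) ∨ h = r.endA ∨ h = r.endB := by
  refine (r.mate_inclHalf_cases h).imp_left fun hm => ?_
  simp only [SurfaceDiagram.nextCorner, hm]
  rfl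

theorem face_two :
    D'.face (r.crossing, r.loopCorner + 2) = D'.face (r.inclHalf r.endA) := by
  rw [← r.next_inclHalf_endA, D'.face_nextCorner]

theorem face_one :
    D'.face (r.crossing, r.loopCorner + 1) = D'.face (r.inclHalf r.endB) := by
  rw [← r.next_inclHalf_endB, D'.face_nextCorner]

theorem face_three :
    D'.face (r.crossing, r.loopCorner + 3) = D'.face (r.inclHalf r.endB) := by
  rw [← r.next_one, D'.face_nextCorner, r.face_one]

theorem face_inclHalf_next (h : HalfEdge Y) :
    D'.face (r.inclHalf (D.nextCorner h)) = D'.face (r.inclHalf h) := by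
  rcases r.next_inclHalf_cases h with hn | rfl | rfl
  · rw [← hn, D'.face_nextCorner]
  · rw [← r.next_two, D'.face_nextCorner, r.face_two]
  · rw [← r.next_three, D'.face_nextCorner, r.face_three]

/-- The face of `D'` that results from a face of `D`. -/
def inclFace : D.Face → D'.Face :=
  Quot.lift (fun h => D'.face (r.inclHalf h)) fun h _ e =>
    e ▸ (r.face_inclHalf_next h).symm

/-- The face of `D` to which a corner of `D'` belongs, if it is not the corner in the loop. -/
def cornerFace (h : HalfEdge X) : Option D.Face :=
  match r.crossingEquiv.symm h.1 with
  | some y => some (D.face (y, h.2))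
  | none => if h.2 = r.loopCorner then none
    else if h.2 = r.loopCorner + 2 then some (D.face r.endA) else some (D.face r.endB)

theorem cornerFace_inclHalf (h : HalfEdge Y) :
    r.cornerFace (r.inclHalf h) = some (D.face h) := by
  simp [cornerFace, inclHalf]

theorem cornerFace_zero : r.cornerFace (r.crossing, r.loopCorner) = none := by
  simp [cornerFace]

theorem cornerFace_one :
    r.cornerFace (r.crossing, r.loopCorner + 1) = some (D.face r.endB) := by
  simp [cornerFace]

theorem cornerFace_two :
    r.cornerFace (r.crossing, r.loopCorner + 2) = some (D.face r.endA) := by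
  simp [cornerFace]

theorem cornerFace_three :
    r.cornerFace (r.crossing, r.loopCorner + 3) = some (D.face r.endB) := by
  simp [cornerFace]

/-- This invariance lets `cornerFace` descend to the faces of `D'`, where it is the inverse in
`faceEquiv`. -/
theorem cornerFace_next (h : HalfEdge X) : r.cornerFace (D'.nextCorner h) = r.cornerFace h := by
  obtain ⟨x, j⟩ := h
  rcases r.exists_incl_or x with rfl | ⟨y, rfl⟩
  · rcases r.eq_loop_add j with rfl | rfl | rfl | rfl
    · rw [r.next_zero]
    · rw [r.next_one, r.cornerFace_one, r.cornerFace_three]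
    · rw [r.next_two, r.cornerFace_inclHalf, r.cornerFace_two, D.face_nextCorner]
    · rw [r.next_three, r.cornerFace_inclHalf, r.cornerFace_three, D.face_nextCorner]
  · change r.cornerFace (D'.nextCorner (r.inclHalf (y, j))) = r.cornerFace (r.inclHalf (y, j))
    generalize (y, j) = h
    rcases r.next_inclHalf_cases h with hn | rfl | rfl
    · rw [hn, r.cornerFace_inclHalf, r.cornerFace_inclHalf, D.face_nextCorner]
    · rw [r.next_inclHalf_endA, r.cornerFace_inclHalf, r.cornerFace_two]
    · rw [r.next_inclHalf_endB, r.cornerFace_inclHalf, r.cornerFace_one]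

/-- The faces of `D'` are the face in the loop and the faces of `D`. -/
def faceEquiv : Option D.Face ≃ D'.Face where
  toFun o := o.elim (D'.face (r.crossing, r.loopCorner)) r.inclFace
  invFun := Quot.lift r.cornerFace fun h _ e => e ▸ (r.cornerFace_next h).symm
  left_inv := by
    rintro (_ | F)
    · exact r.cornerFace_zero
    · obtain ⟨h, rfl⟩ := Quot.exists_rep F
      exact r.cornerFace_inclHalf h
  right_inv := by
    rintro ⟨x, j⟩
    change (r.cornerFace (x, j)).elim _ r.inclFace = D'.face (x, j)
    rcases r.exists_incl_or x with rfl | ⟨y, rfl⟩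
    · rcases r.eq_loop_add j with rfl | rfl | rfl | rfl
      · rw [r.cornerFace_zero]; rfl
      · rw [r.cornerFace_one, r.face_one]; rfl
      · rw [r.cornerFace_two, r.face_two]; rfl
      · rw [r.cornerFace_three, r.face_three]; rfl
    · change (r.cornerFace (r.inclHalf (y, j))).elim _ r.inclFace = _
      rw [r.cornerFace_inclHalf]; rfl

/-! ### Colourings and their weights -/

/-- The colouring of the faces of `D'` given by the colour of the face in the loop and the colours
of the faces of `D`. -/
def extend (b : Bool) (σ : D.Face → Bool) : D'.Face → Bool :=
  fun F => (r.faceEquiv.symm F).elim b σ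

theorem extend_loop (b : Bool) (σ : D.Face → Bool) :
    r.extend b σ (D'.face (r.crossing, r.loopCorner)) = b := by
  -- By definition, the inverse of `faceEquiv` at the face of a corner is `cornerFace`.
  change (r.cornerFace _).elim b σ = b
  rw [r.cornerFace_zero]; rfl

theorem extend_inclHalf (b : Bool) (σ : D.Face → Bool) (h : HalfEdge Y) :
    r.extend b σ (D'.face (r.inclHalf h)) = σ (D.face h) := by
  change (r.cornerFace _).elim b σ = _
  rw [r.cornerFace_inclHalf]; rfl

/-- A colouring of the faces of `D'` is a colour of the face in the loop together with a colouring
of the faces of `D`. -/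
def colouringEquiv : (D.Face → Bool) × Bool ≃ (D'.Face → Bool) where
  toFun p := r.extend p.2 p.1
  invFun τ := (fun F => τ (r.faceEquiv (some F)), τ (r.faceEquiv none))
  left_inv p := by simp [extend]
  right_inv τ := by
    funext F
    obtain ⟨o, rfl⟩ := r.faceEquiv.surjective F
    cases o <;> simp [extend]

/-- The loop separates its inside from `B`. The two halves of the edge that carried the curl both
separate `A` from `B`, as that edge did in `D`. Every other edge keeps its two sides. -/
theorem isProper_extend (b : Bool) (σ : D.Face → Bool) :
    D'.IsProper (r.extend b σ) ↔ D.IsProper σ ∧ ¬ (b = true ∧ σ (D.face r.endB) = true) := by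
  simp only [SurfaceDiagram.isProper_iff]
  constructor
  · intro H
    refine ⟨fun h => ?_, ?_⟩
    · rcases r.mate_inclHalf_cases h with hm | rfl | rfl
      · have := H (r.inclHalf h)
        rwa [hm, r.extend_inclHalf, r.extend_inclHalf] at this
      · have := H (r.inclHalf r.endA)
        rwa [r.mate_inclHalf_endA, r.face_three, r.extend_inclHalf, r.extend_inclHalf,
          ← r.mate_endA] at this
      · have := H (r.inclHalf r.endB)
        rwa [r.mate_inclHalf_endB, r.face_two, r.extend_inclHalf, r.extend_inclHalf,
          ← r.mate_endB] at this
    · have := H (r.crossing, r.loopCorner)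
      rwa [r.mate_loop_in, r.face_one, r.extend_loop, r.extend_inclHalf] at this
  · rintro ⟨H, hb⟩ ⟨x, j⟩
    rcases r.exists_incl_or x with rfl | ⟨y, rfl⟩
    · rcases r.eq_loop_add j with rfl | rfl | rfl | rfl
      · rwa [r.mate_loop_in, r.face_one, r.extend_loop, r.extend_inclHalf]
      · rwa [r.mate_loop_out, r.face_one, r.extend_loop, r.extend_inclHalf, and_comm]
      · have := H r.endA
        rwa [r.mate_two, r.face_two, r.extend_inclHalf, r.extend_inclHalf, ← r.mate_endA]
      · have := H r.endB
        rwa [r.mate_three, r.face_three, r.extend_inclHalf, r.extend_inclHalf, ← r.mate_endB]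
    · change ¬ (r.extend b σ (D'.face (r.inclHalf (y, j))) = true ∧
        r.extend b σ (D'.face (D'.mate (r.inclHalf (y, j)))) = true)
      generalize (y, j) = h
      have := H h
      rcases r.mate_inclHalf_cases h with hm | rfl | rfl
      · rwa [hm, r.extend_inclHalf, r.extend_inclHalf]
      · rwa [r.mate_inclHalf_endA, r.face_three, r.extend_inclHalf, r.extend_inclHalf,
          ← r.mate_endA]
      · rwa [r.mate_inclHalf_endB, r.face_two, r.extend_inclHalf, r.extend_inclHalf,
          ← r.mate_endB]

variable {A : Type*} [CommRing A]

theorem faceWeight_extend (v : StateVar → A) (b : Bool) (σ : D.Face → Bool) :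
    D'.faceWeight v (r.extend b σ) = v (.face b) * D.faceWeight v σ := by
  unfold SurfaceDiagram.faceWeight
  rw [← Equiv.prod_comp r.faceEquiv, Fintype.prod_option]
  simp [extend]

theorem positive_incl (y : Y) : D'.positive (r.incl y) = D.positive y := by
  simp [SurfaceDiagram.positive, r.overStrand_incl]

theorem crossingWeight_extend (v : StateVar → A) (b : Bool) (σ : D.Face → Bool) :
    D'.crossingWeight v (r.extend b σ) =
      crossingValue v (D'.positive r.crossing)
        (decimal fun i => r.extend b σ (D'.face (r.crossing, i))) * D.crossingWeight v σ := by
  unfold SurfaceDiagram.crossingWeight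
  rw [← Equiv.prod_comp r.crossingEquiv, Fintype.prod_option]
  congr 1
  refine Finset.prod_congr rfl fun y _ => ?_
  rw [crossingEquiv_some, r.positive_incl]
  congr 2
  funext i
  exact r.extend_inclHalf b σ (y, i)

/-- For both senses `B` occupies the corners `0` and `2`, whence `8 + 2 = 10`. The loop face and `A`
occupy the corners `1` and `3`, of values 4 and 1, in an order that depends on the sense. -/
theorem decimal_crossing (b : Bool) (σ : D.Face → Bool) :
    (decimal fun i => r.extend b σ (D'.face (r.crossing, i))) =
      10 * (σ (D.face r.endB)).toNat +
        match r.rotation with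
        | .clockwise => 4 * b.toNat + (σ (D.face r.endA)).toNat
        | .counterclockwise => 4 * (σ (D.face r.endA)).toNat + b.toNat := by
  have h0 := r.extend_loop b σ
  have h1 := congrArg (r.extend b σ) r.face_one
  have h2 := congrArg (r.extend b σ) r.face_two
  have h3 := congrArg (r.extend b σ) r.face_three
  rw [r.extend_inclHalf] at h1 h2 h3
  unfold loopCorner at h0 h1 h2 h3
  unfold decimal
  cases hr : r.rotation <;> simp only [hr] at h0 h1 h2 h3
  · change _ = b at h0
    change r.extend b σ (D'.face (r.crossing, 2)) = _ at h1
    change r.extend b σ (D'.face (r.crossing, 3)) = _ at h2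
    change r.extend b σ (D'.face (r.crossing, 0)) = _ at h3
    simp only [h0, h1, h2, h3]
    ring
  · change _ = b at h0
    change r.extend b σ (D'.face (r.crossing, 0)) = _ at h1
    change r.extend b σ (D'.face (r.crossing, 1)) = _ at h2
    change r.extend b σ (D'.face (r.crossing, 2)) = _ at h3
    simp only [h0, h1, h2, h3]
    ring

theorem eval_eq (v : StateVar → A) (hv : CurlIdentities v)
    (hrot : r.rotation = Rotation.clockwise ∨ ∀ ε : Bool, v (cv ε 1) = v (cv ε 4)) :
    D'.eval v = v f₀ * v (cv (D'.positive r.crossing) 10) * D.eval v := by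
  classical
  rw [SurfaceDiagram.eval_eq_sum, SurfaceDiagram.eval_eq_sum,
    ← Equiv.sum_comp r.colouringEquiv, Fintype.sum_prod_type, Finset.mul_sum]
  refine Finset.sum_congr rfl fun σ _ => ?_
  simp only [colouringEquiv, Equiv.coe_fn_mk, Fintype.sum_bool, r.isProper_extend,
    r.faceWeight_extend, r.crossingWeight_extend, r.decimal_crossing]
  generalize D'.positive r.crossing = ε
  by_cases hσ : D.IsProper σ
  swap
  · simp [hσ]
  -- The two faces share the edge that carries the curl, so only three colour patterns remain below.
  have hAB : ¬ (σ (D.face r.endA) = true ∧ σ (D.face r.endB) = true) := by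
    have := (D.isProper_iff σ).1 hσ r.endA
    rwa [r.mate_endA] at this
  obtain ⟨h1, h2⟩ := hv ε
  generalize D.crossingWeight v σ = P
  generalize D.faceWeight v σ = Q
  have c0 : crossingValue v ε 0 = v (cv ε 0) := rfl
  have c1 : crossingValue v ε 1 = v (cv ε 1) := rfl
  have c4 : crossingValue v ε 4 = v (cv ε 4) := rfl
  have c5 : crossingValue v ε 5 = v (cv ε 5) := rfl
  have c10 : crossingValue v ε 10 = v (cv ε 10) := rfl
  change _ = v (.face false) * v (cv ε 10) * _
  simp only [f₀, f₁] at h1 h2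
  generalize σ (D.face r.endA) = p at hAB ⊢
  generalize σ (D.face r.endB) = q at hAB ⊢
  cases hr : r.rotation
  · cases p <;> cases q <;> simp [hσ, c0, c1, c4, c5, c10] at hAB ⊢
    · linear_combination P * Q * h1
    · ring
    · linear_combination -P * Q * h2
  · have h14 : v (cv ε 1) = v (cv ε 4) := by
      rcases hrot with h | h
      · rw [hr] at h; cases h
      · exact h ε
    cases p <;> cases q <;> simp [hσ, c0, c1, c4, c5, c10] at hAB ⊢
    · linear_combination P * Q * h1 + P * Q * v (.face true) * h14
    · ring
    · linear_combination -P * Q * h2 - P * Q * v (.face false) * h14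

end CurlRemoval

/-! ### The assignment in the quotient ring -/

section assignment

variable {A : Type*} [CommRing A]

theorem pow_five_eq_one {s : A} (hs : 1 + s + s ^ 2 + s ^ 3 + s ^ 4 = 0) : s ^ 5 = 1 := by
  linear_combination (s - 1) * hs

/-- For negative crossings, the first identity is `S` times the homogeneous quartic once `s ^ 6` is
reduced to `s`; the second needs only `S ^ 5 = 1`. Exchanging `s` and `S` gives the positive case.
-/
theorem curlIdentities_assignment {s S : A} (hs : s ^ 5 = 1) (hS : S ^ 5 = 1)
    (h : s ^ 4 + s ^ 3 * S + s ^ 2 * S ^ 2 + s * S ^ 3 + S ^ 4 = 0) :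
    CurlIdentities (assignment s S) := by
  intro ε
  cases ε <;> refine ⟨?_, ?_⟩ <;> simp [assignment, f₀, f₁, cv]
  · linear_combination S * h + s * S ^ 4 * hs
  · linear_combination s ^ 2 * S ^ 3 * hS
  · linear_combination s * h + s ^ 4 * S * hS
  · linear_combination s ^ 3 * S ^ 2 * hs

theorem f₀_mul_cv_ten {s S : A} (hs : s ^ 5 = 1) (hS : S ^ 5 = 1) (ε : Bool) :
    assignment s S f₀ * assignment s S (cv ε 10) =
      if ε = true then -(s ^ 4 * S) else -(s * S ^ 4) := by
  cases ε <;> simp [assignment, f₀, cv]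
  · linear_combination s * S ^ 4 * hs
  · linear_combination s ^ 4 * S * hS

theorem assignment_one_eq_four (s S : A) (ε : Bool) :
    assignment s S (cv ε 1) = assignment s S (cv ε 4) := by
  cases ε <;> simp [assignment, cv]

end assignment

theorem sHat_pow_five : sHat ^ 5 = 1 :=
  pow_five_eq_one <| Ideal.Quotient.eq_zero_iff_mem.2 <| Ideal.subset_span (by simp)

theorem SHat_pow_five : SHat ^ 5 = 1 :=
  pow_five_eq_one <| Ideal.Quotient.eq_zero_iff_mem.2 <| Ideal.subset_span (by simp)

theorem sHat_SHat_homogeneous :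
    sHat ^ 4 + sHat ^ 3 * SHat + sHat ^ 2 * SHat ^ 2 + sHat * SHat ^ 3 + SHat ^ 4 = 0 :=
  Ideal.Quotient.eq_zero_iff_mem.2 <| Ideal.subset_span (by simp)

theorem curlIdentities_quotRing : CurlIdentities (assignment sHat SHat) :=
  curlIdentities_assignment sHat_pow_five SHat_pow_five sHat_SHat_homogeneous

end

end FacialState

theorem mainTheorem7 :
    -- general form: the identities make every curl removal a constant factor; a counterclockwise
    -- curl uses in addition that the assignment has `x₁ = x₄` and `X₁ = X₄`
    (∀ (A : Type*) [CommRing A] (v : FacialState.StateVar → A),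
      FacialState.CurlIdentities v →
      ∀ (X Y : Type*) [Fintype X] [Fintype Y]
        (D' : FacialState.LinkDiagram X) (D : FacialState.LinkDiagram Y)
        (r : FacialState.CurlRemoval D' D),
        (r.rotation = FacialState.Rotation.clockwise ∨
          ∀ ε : Bool, v (FacialState.cv ε 1) = v (FacialState.cv ε 4)) →
        D'.eval v =
          v FacialState.f₀ * v (FacialState.cv (D'.positive r.crossing) 10) * D.eval v) ∧
    -- the identities hold in the quotient ring
    FacialState.CurlIdentities (FacialState.assignment FacialState.sHat FacialState.SHat) ∧
    -- the effect of the four types of curls in the quotient ring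
    (∀ (X Y : Type*) [Fintype X] [Fintype Y]
        (D' : FacialState.LinkDiagram X) (D : FacialState.LinkDiagram Y)
        (r : FacialState.CurlRemoval D' D),
        D'.eval (FacialState.assignment FacialState.sHat FacialState.SHat) =
          (if D'.positive r.crossing = true
            then -(FacialState.sHat ^ 4 * FacialState.SHat)
            else -(FacialState.sHat * FacialState.SHat ^ 4)) *
          D.eval (FacialState.assignment FacialState.sHat FacialState.SHat)) := by
  refine ⟨fun A _ v hv X Y _ _ D' D r hr => r.eval_eq v hv hr,
    FacialState.curlIdentities_quotRing, fun X Y _ _ D' D r => ?_⟩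
  rw [r.eval_eq _ FacialState.curlIdentities_quotRing
    (Or.inr (FacialState.assignment_one_eq_four _ _)),
    FacialState.f₀_mul_cv_ten FacialState.sHat_pow_five FacialState.SHat_pow_five]
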